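/- Let $a>0$, $b>0$, $\lambda>0$. Let $X_1,X_2,\dots$ be i.i.d. real random variables with values in the lattice $a\mathbb Z$, where $a$ is the step of the distribution (no $a'\mathbb Z$ with $a'>a$ carries it), and let $N(t)$, $t\ge 0$, be a Poisson process with intensity $\lambda$ that is independent of the sequence $(X_k)$. Put $Z(t)=\sum_{k=1}^{N(t)}X_k$ (a compound Poisson process) and $X(t)=Z(t)-bt$. Assume that $$P(X_1>na)>0\ \text{ for all } n\in\mathbb N\qquad\text{and}\qquad \lim_{n\to\infty}\frac{P(X_1>(n+1)a)}{P(X_1>na)}=0 .$$ Then $P(X(1)>u)>0$ for every real $u$ and $$\limsup_{u\to\infty}\frac{P\left(\sup_{0\le t\le1}X(t)>u\right)}{P(X(1)>u)}=\infty ,\qquad \liminf_{u\to\infty}\frac{P\left(\sup_{0\le t\le1}X(t)>u\right)}{P(X(1)>u)}=1 .$$ -/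

import Mathlib

open MeasureTheory ProbabilityTheory Filter Topology
open scoped NNReal ENNReal

/-- `N` is a (homogeneous) Poisson process with intensity `r`: it starts at `0`, has independent
increments, the increment over `(s, t]` has the Poisson law with parameter `r * (t - s)`, and almost
every path is nondecreasing and right-continuous. (The subtraction `N t ω - N s ω` in `ℕ` is the true
one for almost every `ω`, because almost every path is nondecreasing.) -/
structure IsPoissonProcess {Ω : Type*} [MeasurableSpace Ω] (N : ℝ≥0 → Ω → ℕ) (r : ℝ≥0)
    (P : Measure Ω) : Prop where
  measurable : ∀ t, Measurable (N t)
  zero : ∀ᵐ ω ∂P, N 0 ω = 0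
  indep_increments : HasIndepIncrements (fun t ω => (N t ω : ℝ)) P
  law_increments : ∀ s t : ℝ≥0, s ≤ t →
    P.map (fun ω => N t ω - N s ω) = poissonMeasure (r * (t - s))
  monotone_paths : ∀ᵐ ω ∂P, Monotone (fun t => N t ω)
  rightContinuous_paths : ∀ᵐ ω ∂P, ∀ t : ℝ≥0, ContinuousWithinAt (fun s => N s ω) (Set.Ici t) t

/-- The counting process `N` and the jumps `ξ 0, ξ 1, …` are the data of a compound Poisson process
with parameter `r`: `N` is a Poisson process with intensity `r`, the jumps are iid real random
variables, and the process `N` is independent of the sequence `ξ`. -/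
structure IsCompoundPoissonData {Ω : Type*} [MeasurableSpace Ω] (N : ℝ≥0 → Ω → ℕ)
    (ξ : ℕ → Ω → ℝ) (r : ℝ≥0) (P : Measure Ω) : Prop where
  poisson : IsPoissonProcess N r P
  measurable_jump : ∀ k, Measurable (ξ k)
  indep_jumps : iIndepFun ξ P
  identDistrib_jumps : ∀ k, IdentDistrib (ξ k) (ξ 0) P P
  indep : IndepFun (fun ω t => N t ω) (fun ω k => ξ k ω) P

/-- The compound Poisson process `Z t = ξ 0 + ⋯ + ξ (N t - 1)`, the sum of the first `N t` jumps. -/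
def compoundPoisson {Ω : Type*} (N : ℝ≥0 → Ω → ℕ) (ξ : ℕ → Ω → ℝ) (t : ℝ≥0) (ω : Ω) : ℝ :=
  ∑ k ∈ Finset.range (N t ω), ξ k ω

/-- The process with drift, `X t = Z t - b * t`. -/
def driftedCompoundPoisson {Ω : Type*} (N : ℝ≥0 → Ω → ℕ) (ξ : ℕ → Ω → ℝ) (b : ℝ) (t : ℝ≥0)
    (ω : Ω) : ℝ :=
  compoundPoisson N ξ t ω - b * (t : ℝ)

/-- The supremum of a path over the time interval `[0, 1]`, as an extended real number. -/
noncomputable def supUnitInterval {Ω : Type*} (X : ℝ≥0 → Ω → ℝ) (ω : Ω) : EReal :=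
  ⨆ t ∈ Set.Icc (0 : ℝ≥0) 1, (X t ω : EReal)

/-- The random variable `Y` takes values in the lattice `a ℤ` almost surely, `a > 0`, and `a` is the
step of the distribution: no strictly coarser lattice `a' ℤ`, `a' > a`, carries it. -/
def IsLatticeWithStep {Ω : Type*} [MeasurableSpace Ω] (Y : Ω → ℝ) (a : ℝ) (P : Measure Ω) : Prop :=
  0 < a ∧ (∀ᵐ ω ∂P, ∃ n : ℤ, Y ω = n * a) ∧
    ∀ a' : ℝ, a < a' → ¬ ∀ᵐ ω ∂P, ∃ n : ℤ, Y ω = n * a'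

/-! Let `φ s` be the exponential moment of a jump at `s`. The vanishing tail ratio makes `φ` finite
everywhere, so `Z t` has moment `exp (r * t * (φ s - 1))`, and both limits follow by contradiction
from this formula. The position of `u + b` relative to the lattice decides which limit appears.

For the limsup take `u + b = (n + 1) * a`. Almost surely `N` does not jump at time 1, so if `Z 1`
equals `u + b`, this value is already held just before 1, where the drift is less than `b`: the
supremum exceeds `u` although `X 1` does not. A bounded ratio would thus make the lattice tail of `Z
1` decay at most geometrically, contradicting finite moments (`limsup_ratio_eq_top`).

For the liminf take `u + b = (n - 1 / 2) * a`. On `[t₀, 1]`, with `t₀` close to 1, the missing drift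
is at most `a / 2`, so the lattice forces a crossing by `X` to be a crossing of `u + b` by `Z`. The
running maximum of the partial sums up to `N 1` costs only a factor `1 + ε`, because a Poisson tail
from `j` on is asymptotic to its mass at `j`. The remaining terms are tails of `Z t₀`; they cannot
dominate a fixed fraction of the tail of `Z 1` at all large levels, since `φ` grows exponentially
and `exp (r * (φ s - 1))` outgrows `exp (r * t₀ * (φ s - 1))` (`not_eventually_measure_lt_le`). -/

/-! ### Evaluation at an independent random index -/

theorem lintegral_comp_randomIndex {Ω S : Type*} [MeasurableSpace Ω] [MeasurableSpace S]
    {P : Measure Ω} {N : Ω → ℕ} {X : Ω → S} (hN : Measurable N) (hX : Measurable X)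
    (hind : IndepFun N X P) {F : ℕ → S → ℝ≥0∞} (hF : ∀ k, Measurable (F k)) :
    ∫⁻ ω, F (N ω) (X ω) ∂P = ∑' k, P.map N {k} * ∫⁻ ω, F k (X ω) ∂P := by
  have key : ∀ ω, F (N ω) (X ω) = ∑' k, Set.indicator {k} (fun _ => (1 : ℝ≥0∞)) (N ω) * F k (X ω) := by
    intro ω
    rw [tsum_eq_single (N ω)]
    · simp
    · intro k hk
      simp [Set.indicator, Ne.symm hk]
  have hind1 : ∀ k : ℕ, Measurable (Set.indicator {k} (fun _ : ℕ => (1 : ℝ≥0∞))) := fun k =>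
    measurable_of_countable _
  simp_rw [key]
  have hm : ∀ k, Measurable fun ω =>
      Set.indicator {k} (fun _ : ℕ => (1 : ℝ≥0∞)) (N ω) * F k (X ω) :=
    fun k => ((hind1 k).comp hN).mul ((hF k).comp hX)
  rw [lintegral_tsum (fun k => (hm k).aemeasurable)]
  refine tsum_congr fun k => ?_
  have := lintegral_mul_eq_lintegral_mul_lintegral_of_indepFun ((hind1 k).comp hN)
    ((hF k).comp hX) (hind.comp (hind1 k) (hF k))
  simp only [Pi.mul_apply, Function.comp_apply] at this
  rw [this, ← lintegral_map (hind1 k) hN, lintegral_indicator (measurableSet_singleton k)]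
  simp

theorem measure_comp_randomIndex {Ω S : Type*} [MeasurableSpace Ω] [MeasurableSpace S]
    {P : Measure Ω} {N : Ω → ℕ} {X : Ω → S} (hN : Measurable N) (hX : Measurable X)
    (hind : IndepFun N X P) {A : ℕ → Set S} (hA : ∀ k, MeasurableSet (A k)) :
    P {ω | X ω ∈ A (N ω)} = ∑' k, P.map N {k} * P {ω | X ω ∈ A k} := by
  have h := lintegral_comp_randomIndex hN hX hind
    (F := fun k => (A k).indicator (fun _ => (1 : ℝ≥0∞))) (fun k => measurable_const.indicator (hA k))
  have e : ∀ k, ∫⁻ ω, (A k).indicator (fun _ => (1 : ℝ≥0∞)) (X ω) ∂P = P {ω | X ω ∈ A k} := by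
    intro k
    exact lintegral_indicator_one (hX (hA k))
  have hm : MeasurableSet {ω | X ω ∈ A (N ω)} := by
    have : {ω | X ω ∈ A (N ω)} = ⋃ k, (N ⁻¹' {k} ∩ X ⁻¹' (A k)) := by
      ext ω; simp
    rw [this]
    exact MeasurableSet.iUnion fun k => (hN (measurableSet_singleton k)).inter (hX (hA k))
  simp_rw [e] at h
  rw [← h]
  exact (lintegral_indicator_one hm).symm

/-! ### Poisson tails and running maxima -/

theorem poissonMeasure_singleton_add_le (μ : ℝ≥0) (j i : ℕ) :
    poissonMeasure μ {j + i} ≤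
      poissonMeasure μ {j} * ENNReal.ofReal (μ / (j + 1)) ^ i := by
  rw [poissonMeasure_singleton, poissonMeasure_singleton, ← ENNReal.ofReal_pow (by positivity),
    ← ENNReal.ofReal_mul (by positivity)]
  apply ENNReal.ofReal_le_ofReal
  have h : (j.factorial : ℝ) * (j + 1) ^ i ≤ (j + i).factorial := by
    exact_mod_cast Nat.factorial_mul_pow_le_factorial (m := j) (n := i)
  rw [div_pow, div_mul_div_comm, mul_assoc, ← pow_add]
  gcongr

theorem poissonMeasure_Ici_le (μ : ℝ≥0) (j : ℕ) :
    poissonMeasure μ (Set.Ici j) ≤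
      poissonMeasure μ {j} * (1 - ENNReal.ofReal (μ / (j + 1)))⁻¹ := by
  have : Set.Ici j = ⋃ i : ℕ, {j + i} := by
    ext k
    simp only [Set.mem_Ici, Set.mem_iUnion, Set.mem_singleton_iff]
    exact le_iff_exists_add
  rw [this, ← ENNReal.tsum_geometric, ← ENNReal.tsum_mul_left]
  exact (measure_iUnion_le _).trans (ENNReal.tsum_le_tsum (poissonMeasure_singleton_add_le μ j))

theorem eventually_poissonMeasure_Ici_le (μ : ℝ≥0) {ε : ℝ≥0} (hε : 0 < ε) :
    ∀ᶠ j : ℕ in atTop, poissonMeasure μ (Set.Ici j) ≤ (1 + ε) * poissonMeasure μ {j} := by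
  have h0 : Tendsto (fun j : ℕ => ENNReal.ofReal (μ / (j + 1))) atTop (𝓝 0) := by
    rw [← ENNReal.ofReal_zero]
    exact (ENNReal.continuous_ofReal.tendsto _).comp
      (tendsto_const_nhds.div_atTop (tendsto_atTop_add_const_right _ _ tendsto_natCast_atTop_atTop))
  have h1 : Tendsto (fun j : ℕ => (1 - ENNReal.ofReal (μ / (j + 1)))⁻¹) atTop (𝓝 1) := by
    have := (ENNReal.Tendsto.sub (tendsto_const_nhds (x := (1 : ℝ≥0∞))) h0 (by simp)).inv
    simpa using this
  have h2 : (1 : ℝ≥0∞) < 1 + ε := by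
    exact ENNReal.lt_add_right (by simp) (by simpa using hε.ne')
  filter_upwards [h1.eventually_le_const h2] with j hj
  rw [mul_comm]
  exact (poissonMeasure_Ici_le μ j).trans (by gcongr)

/-- The asymptotic bound fails only for finitely many `j`, and there any Poisson law of positive
parameter has positive mass. Taking `μ' < μ` later makes the correction term negligible. -/
theorem exists_poissonMeasure_Ici_le (μ : ℝ≥0) {μ' : ℝ≥0} (hμ' : 0 < μ') {ε : ℝ≥0} (hε : 0 < ε) :
    ∃ C : ℝ≥0, ∀ j : ℕ, poissonMeasure μ (Set.Ici j) ≤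
      (1 + ε) * poissonMeasure μ {j} + C * poissonMeasure μ' {j} := by
  obtain ⟨K, hK⟩ := eventually_atTop.1 (eventually_poissonMeasure_Ici_le μ hε)
  have hp : ∀ j, poissonMeasure μ' {j} ≠ 0 := fun j => by
    rw [poissonMeasure_singleton]
    have : (0 : ℝ) < μ' := hμ'
    simp only [ne_eq, ENNReal.ofReal_eq_zero, not_le]
    positivity
  have hfin : ∑ j ∈ Finset.range K, (poissonMeasure μ' {j})⁻¹ ≠ ∞ :=
    ENNReal.sum_ne_top.2 fun j _ => ENNReal.inv_ne_top.2 (hp j)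
  refine ⟨(∑ j ∈ Finset.range K, (poissonMeasure μ' {j})⁻¹).toNNReal, fun j => ?_⟩
  rw [ENNReal.coe_toNNReal hfin]
  rcases le_or_gt K j with h | h
  · exact (hK j h).trans le_self_add
  · calc poissonMeasure μ (Set.Ici j) ≤ 1 := prob_le_one
      _ = (poissonMeasure μ' {j})⁻¹ * poissonMeasure μ' {j} :=
        (ENNReal.inv_mul_cancel (hp j) (measure_ne_top _ _)).symm
      _ ≤ (∑ j ∈ Finset.range K, (poissonMeasure μ' {j})⁻¹) * poissonMeasure μ' {j} := by
        gcongr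
        exact Finset.single_le_sum (f := fun j => (poissonMeasure μ' {j})⁻¹) (fun _ _ => zero_le)
          (Finset.mem_range.2 h)
      _ ≤ _ := le_add_self

/-- The probability that the running maximum of a sequence, stopped at an independent Poisson index,
exceeds a level, is bounded by tails of the sequence evaluated at Poisson indices. -/
theorem exists_tsum_poissonMeasure_exists_le {Ω : Type*} [MeasurableSpace Ω] (P : Measure Ω)
    (S : ℕ → Ω → ℝ) (μ : ℝ≥0) {μ' : ℝ≥0} (hμ' : 0 < μ') {ε : ℝ≥0} (hε : 0 < ε) :
    ∃ C : ℝ≥0, ∀ x : ℝ, ∑' k, poissonMeasure μ {k} * P {ω | ∃ j ≤ k, x < S j ω} ≤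
      (1 + ε) * ∑' k, poissonMeasure μ {k} * P {ω | x < S k ω} +
        C * ∑' k, poissonMeasure μ' {k} * P {ω | x < S k ω} := by
  obtain ⟨C, hC⟩ := exists_poissonMeasure_Ici_le μ hμ' hε
  refine ⟨C, fun x => ?_⟩
  -- First passage at index `j`. Exchanging the sums weights `H j` by the Poisson tail from `j` on.
  set H : ℕ → Set Ω := fun j => {ω | x < S j ω ∧ ∀ i < j, ¬ x < S i ω}
  have hle : ∀ k, P {ω | ∃ j ≤ k, x < S j ω} ≤ ∑' j, (Set.Ici j).indicator 1 k * P (H j) := by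
    intro k
    have hsub : {ω | ∃ j ≤ k, x < S j ω} ⊆ ⋃ j ∈ Finset.range (k + 1), H j := by
      classical
      rintro ω ⟨j, hj, hx⟩
      have hex : ∃ j, x < S j ω := ⟨j, hx⟩
      simp only [Set.mem_iUnion]
      refine ⟨Nat.find hex, ?_, Nat.find_spec hex, fun i hi => Nat.find_min hex hi⟩
      exact Finset.mem_range.2 (Nat.lt_succ_of_le ((Nat.find_min' hex hx).trans hj))
    refine (measure_mono hsub).trans ((measure_biUnion_finset_le _ _).trans ?_)
    refine le_trans (Finset.sum_le_sum fun j hj => ?_) (ENNReal.sum_le_tsum (Finset.range (k + 1)))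
    have : j ≤ k := Nat.lt_succ_iff.1 (Finset.mem_range.1 hj)
    simp [this]
  have htail : ∀ j, ∑' k, poissonMeasure μ {k} * (Set.Ici j).indicator 1 k =
      poissonMeasure μ (Set.Ici j) := by
    intro j
    rw [← lintegral_indicator_one (MeasurableSet.of_discrete), lintegral_countable']
    exact tsum_congr fun k => mul_comm _ _
  calc ∑' k, poissonMeasure μ {k} * P {ω | ∃ j ≤ k, x < S j ω}
      ≤ ∑' k, poissonMeasure μ {k} * ∑' j, (Set.Ici j).indicator 1 k * P (H j) :=
        ENNReal.tsum_le_tsum fun k => by gcongr; exact hle k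
    _ = ∑' j, poissonMeasure μ (Set.Ici j) * P (H j) := by
        simp_rw [← ENNReal.tsum_mul_left]
        rw [ENNReal.tsum_comm]
        refine tsum_congr fun j => ?_
        rw [← htail, ← ENNReal.tsum_mul_right]
        exact tsum_congr fun k => (mul_assoc _ _ _).symm
    _ ≤ ∑' j, ((1 + ε) * poissonMeasure μ {j} + C * poissonMeasure μ' {j}) *
          P {ω | x < S j ω} :=
        ENNReal.tsum_le_tsum fun j => mul_le_mul' (hC j) (measure_mono fun ω h => h.1)
    _ = _ := by
        rw [← ENNReal.tsum_mul_left, ← ENNReal.tsum_mul_left, ← ENNReal.tsum_add]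
        exact tsum_congr fun j => by ring

/-! ### Tails and exponential moments -/

/-- Layer-cake formula: levels below `y₀` contribute at most their length, since probabilities are
at most 1. -/
theorem lintegral_le_add_of_tail_le {Ω : Type*} [MeasurableSpace Ω] {P : Measure Ω}
    [IsProbabilityMeasure P] {f g : Ω → ℝ} (hf : Measurable f) (hg : Measurable g)
    (hf0 : ∀ ω, 0 ≤ f ω) (hg0 : ∀ ω, 0 ≤ g ω) {y₀ : ℝ} {C : ℝ≥0∞}
    (h : ∀ y ≥ y₀, 0 < y → P {ω | y < f ω} ≤ C * P {ω | y < g ω}) :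
    ∫⁻ ω, ENNReal.ofReal (f ω) ∂P ≤ ENNReal.ofReal y₀ + C * ∫⁻ ω, ENNReal.ofReal (g ω) ∂P := by
  rw [lintegral_eq_lintegral_meas_lt P (Eventually.of_forall hf0) hf.aemeasurable,
    lintegral_eq_lintegral_meas_lt P (Eventually.of_forall hg0) hg.aemeasurable]
  have hmeas : ∀ f : Ω → ℝ, Measurable fun y : ℝ => P {ω | y < f ω} := fun f =>
    Antitone.measurable fun y y' hy => measure_mono fun ω (hω : y' < f ω) => hy.trans_lt hω
  rw [← lintegral_const_mul _ (hmeas g)]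
  calc ∫⁻ y in Set.Ioi 0, P {ω | y < f ω}
      ≤ ∫⁻ y in Set.Ioi 0, ((Set.Ioo 0 y₀).indicator 1 y + C * P {ω | y < g ω}) := by
        refine setLIntegral_mono ((measurable_one.indicator measurableSet_Ioo).add
          ((hmeas g).const_mul C)) fun y hy => ?_
        rcases lt_or_ge y y₀ with hlt | hge
        · rw [Set.indicator_of_mem (show y ∈ Set.Ioo 0 y₀ from ⟨hy, hlt⟩)]
          exact prob_le_one.trans le_self_add
        · exact (h y hge hy).trans le_add_self
    _ = (∫⁻ y in Set.Ioi 0, (Set.Ioo 0 y₀).indicator 1 y) +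
          ∫⁻ y in Set.Ioi 0, C * P {ω | y < g ω} :=
        lintegral_add_left (measurable_one.indicator measurableSet_Ioo) _
    _ ≤ _ := by
        gcongr
        refine (setLIntegral_le_lintegral _ _).trans ?_
        rw [lintegral_indicator_one measurableSet_Ioo, Real.volume_Ioo, sub_zero]

theorem lintegral_exp_le_of_tail_le {Ω : Type*} [MeasurableSpace Ω] {P : Measure Ω}
    [IsProbabilityMeasure P] {Y Z : Ω → ℝ} (hY : Measurable Y) (hZ : Measurable Z)
    {x₀ m : ℝ} {C : ℝ≥0∞} (h : ∀ x ≥ x₀, P {ω | x < Y ω} ≤ C * P {ω | x - m < Z ω})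
    {s : ℝ} (hs : 0 < s) :
    ∫⁻ ω, ENNReal.ofReal (Real.exp (s * Y ω)) ∂P ≤ ENNReal.ofReal (Real.exp (s * x₀)) +
      C * (ENNReal.ofReal (Real.exp (s * m)) *
        ∫⁻ ω, ENNReal.ofReal (Real.exp (s * Z ω)) ∂P) := by
  have := lintegral_le_add_of_tail_le (P := P) (f := fun ω => Real.exp (s * Y ω))
    (g := fun ω => Real.exp (s * m) * Real.exp (s * Z ω)) (y₀ := Real.exp (s * x₀)) (C := C)
    (by fun_prop) (by fun_prop) (fun _ => by positivity) (fun _ => by positivity) ?_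
  · simp_rw [ENNReal.ofReal_mul (Real.exp_pos _).le] at this
    rwa [lintegral_const_mul _ (by fun_prop)] at this
  · intro y hy hy0
    have h1 : x₀ ≤ Real.log y / s := by
      rw [le_div_iff₀ hs, mul_comm]
      exact (Real.le_log_iff_exp_le hy0).2 hy
    have e1 : {ω | y < Real.exp (s * Y ω)} = {ω | Real.log y / s < Y ω} := by
      ext ω
      simp only [Set.mem_ofPred_eq]
      rw [← Real.log_lt_iff_lt_exp hy0, div_lt_iff₀ hs, mul_comm]
    have e2 : {ω | y < Real.exp (s * m) * Real.exp (s * Z ω)} =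
        {ω | Real.log y / s - m < Z ω} := by
      ext ω
      simp only [Set.mem_ofPred_eq]
      rw [← Real.exp_add, ← Real.log_lt_iff_lt_exp hy0, sub_lt_iff_lt_add, div_lt_iff₀ hs]
      constructor <;> intro h <;> linarith
    rw [e1, e2]
    exact h _ h1

/-- Cutting the values of `Y` into layers of width `a` bounds the moment by a series. Its term ratio
is the tail ratio times `exp (s * a)`, which still tends to 0. -/
theorem lintegral_exp_ne_top_of_tail_ratio {Ω : Type*} [MeasurableSpace Ω] {P : Measure Ω}
    [IsProbabilityMeasure P] {Y : Ω → ℝ} (hY : Measurable Y) {a : ℝ} (ha : 0 < a)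
    (hpos : ∀ n : ℕ, 0 < P.real {ω | (n : ℝ) * a < Y ω})
    (hlim : Tendsto
      (fun n : ℕ => P.real {ω | ((n : ℝ) + 1) * a < Y ω} / P.real {ω | (n : ℝ) * a < Y ω})
      atTop (𝓝 0)) {s : ℝ} (hs : 0 < s) :
    ∫⁻ ω, ENNReal.ofReal (Real.exp (s * Y ω)) ∂P ≠ ∞ := by
  set t : ℕ → ℝ := fun n => P.real {ω | (n : ℝ) * a < Y ω}
  set w : ℕ → ℝ := fun n => Real.exp (s * ((n + 1) * a)) * t n
  have hw : ∀ n, 0 < w n := fun n => mul_pos (Real.exp_pos _) (hpos n)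
  have hsum : Summable w := by
    refine summable_of_ratio_test_tendsto_lt_one (l := 0) one_pos
      (Eventually.of_forall fun n => (hw n).ne') ?_
    have : Tendsto (fun n : ℕ => Real.exp (s * a) * (t (n + 1) / t n)) atTop (𝓝 0) := by
      rw [← mul_zero (Real.exp (s * a))]
      refine Tendsto.const_mul _ (hlim.congr fun n => ?_)
      simp [t]
    refine this.congr fun n => ?_
    rw [Real.norm_of_nonneg (hw _).le, Real.norm_of_nonneg (hw _).le]
    simp only [w]
    have h1 : Real.exp (s * (((n + 1 : ℕ) + 1) * a)) =
        Real.exp (s * a) * Real.exp (s * ((n + 1) * a)) := by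
      rw [← Real.exp_add]; push_cast; ring_nf
    have := (hpos n).ne'
    rw [h1]
    field_simp
  have hpt : ∀ ω, ENNReal.ofReal (Real.exp (s * Y ω)) ≤ 1 + ∑' n : ℕ,
      ENNReal.ofReal (Real.exp (s * ((n + 1) * a))) *
        {ω | (n : ℝ) * a < Y ω}.indicator 1 ω := by
    intro ω
    rcases le_or_gt (Y ω) 0 with h | h
    · refine le_trans ?_ le_self_add
      rw [ENNReal.ofReal_le_one, Real.exp_le_one_iff]
      exact mul_nonpos_of_nonneg_of_nonpos hs.le h
    · refine le_trans ?_ le_add_self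
      obtain ⟨n, hn⟩ := Nat.exists_eq_succ_of_ne_zero (Nat.ceil_pos.2 (div_pos h ha)).ne'
      have h1 : Y ω ≤ (n + 1) * a := by
        have := Nat.le_ceil (Y ω / a)
        rw [hn, div_le_iff₀ ha] at this
        simpa using this
      have h2 : (n : ℝ) * a < Y ω := by
        rw [← lt_div_iff₀ ha]
        exact Nat.lt_ceil.1 (by omega)
      refine le_trans ?_ (ENNReal.le_tsum n)
      rw [Set.indicator_of_mem (show ω ∈ {ω | (n : ℝ) * a < Y ω} from h2), Pi.one_apply, mul_one]
      gcongr
  have hms : ∀ n : ℕ, MeasurableSet {ω | (n : ℝ) * a < Y ω} := fun n =>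
    measurableSet_lt measurable_const hY
  refine ((lintegral_mono hpt).trans_lt ?_).ne
  rw [lintegral_add_left measurable_const, lintegral_tsum fun n =>
    ((measurable_one.indicator (hms n)).const_mul _).aemeasurable]
  simp_rw [lintegral_const_mul _ (measurable_one.indicator (hms _)),
    lintegral_indicator_one (hms _)]
  have : ∀ n : ℕ, ENNReal.ofReal (Real.exp (s * ((n + 1) * a))) * P {ω | (n : ℝ) * a < Y ω} =
      ENNReal.ofReal (w n) := fun n => by
    rw [ENNReal.ofReal_mul (Real.exp_pos _).le, ofReal_measureReal]
  simp_rw [this]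
  rw [← ENNReal.ofReal_tsum_of_nonneg (fun n => (hw n).le) hsum]
  simp

theorem tsum_poissonMeasure_mul_pow (μ : ℝ≥0) {φ : ℝ} (hφ : 0 ≤ φ) :
    ∑' k, poissonMeasure μ {k} * ENNReal.ofReal φ ^ k =
      ENNReal.ofReal (Real.exp (μ * (φ - 1))) := by
  have hs : HasSum (fun k : ℕ => Real.exp (-μ) * ((μ * φ) ^ k / k.factorial))
      (Real.exp (μ * (φ - 1))) := by
    have := (NormedSpace.expSeries_div_hasSum_exp ((μ : ℝ) * φ)).mul_left (Real.exp (-μ))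
    rw [← Real.exp_eq_exp_ℝ, ← Real.exp_add] at this
    convert! this using 2
    ring
  rw [← hs.tsum_eq, ENNReal.ofReal_tsum_of_nonneg (fun k => by positivity) hs.summable]
  refine tsum_congr fun k => ?_
  rw [poissonMeasure_singleton, ← ENNReal.ofReal_pow hφ, ← ENNReal.ofReal_mul (by positivity)]
  congr 1
  rw [mul_pow]; ring

/-- Taking logarithms would bound `(μ₁ - μ₂) * (φ s - 1)` by an affine function of `s`, while `φ`
grows exponentially. -/
theorem not_forall_exp_mul_le {φ : ℝ → ℝ} {c a : ℝ} (hc : 0 < c) (ha : 0 < a)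
    (hφ : ∀ s > 0, c * Real.exp (s * a) ≤ φ s) {μ₁ μ₂ : ℝ} (hμ₂ : 0 ≤ μ₂) (hμ : μ₂ < μ₁)
    (x₀ m C : ℝ) (hC : 0 ≤ C) :
    ¬ ∀ s > 0, Real.exp (μ₁ * (φ s - 1)) ≤
      Real.exp (s * x₀) + C * (Real.exp (s * m) * Real.exp (μ₂ * (φ s - 1))) := by
  intro h
  set D := max x₀ m
  set d := μ₁ - μ₂ with hd
  have hd0 : 0 < d := sub_pos.2 hμ
  set K := Real.exp μ₂ + C with hK
  have hK0 : 0 < K := by positivity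
  have h1 : ∀ s > 0, d * (c * Real.exp (s * a) - 1) ≤ Real.log K + s * D := by
    intro s hs
    have hφ0 : 0 ≤ φ s := le_trans (by positivity) (hφ s hs)
    -- The factor `exp μ₂` cancels the `-1` in the exponent, leaving `exp (μ₂ * φ s) ≥ 1`.
    have e1 : Real.exp (s * x₀) ≤
        Real.exp μ₂ * (Real.exp (s * D) * Real.exp (μ₂ * (φ s - 1))) := by
      rw [← Real.exp_add, ← Real.exp_add]
      apply Real.exp_le_exp.2
      have : s * x₀ ≤ s * D := mul_le_mul_of_nonneg_left (le_max_left _ _) hs.le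
      nlinarith [mul_nonneg hμ₂ hφ0]
    have e2 : Real.exp (s * m) ≤ Real.exp (s * D) :=
      Real.exp_le_exp.2 (mul_le_mul_of_nonneg_left (le_max_right _ _) hs.le)
    have e3 : Real.exp (μ₁ * (φ s - 1)) ≤
        K * (Real.exp (s * D) * Real.exp (μ₂ * (φ s - 1))) := by
      refine (h s hs).trans ?_
      rw [hK, add_mul]
      gcongr
    rw [← Real.exp_log hK0, ← Real.exp_add, ← Real.exp_add, Real.exp_le_exp] at e3
    have e4 : d * (c * Real.exp (s * a) - 1) ≤ d * (φ s - 1) := by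
      gcongr
      exact hφ s hs
    nlinarith
  have h2 : Tendsto (fun s : ℝ => (d * c) * (Real.exp (s * a) / (s * a) ^ 2) -
      (d + Real.log K) / (s * a) ^ 2 - D / a / (s * a)) atTop atTop := by
    have hsa : Tendsto (fun s : ℝ => s * a) atTop atTop := tendsto_id.atTop_mul_const ha
    have t1 : Tendsto (fun s : ℝ => (d * c) * (Real.exp (s * a) / (s * a) ^ 2)) atTop atTop :=
      ((Real.tendsto_exp_div_pow_atTop 2).comp hsa).const_mul_atTop (mul_pos hd0 hc)
    have t2 : Tendsto (fun s : ℝ => (d + Real.log K) / (s * a) ^ 2) atTop (𝓝 0) :=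
      tendsto_const_nhds.div_atTop ((tendsto_pow_atTop two_ne_zero).comp hsa)
    have t3 : Tendsto (fun s : ℝ => D / a / (s * a)) atTop (𝓝 0) :=
      tendsto_const_nhds.div_atTop hsa
    have := (t1.atTop_add t2.neg).atTop_add t3.neg
    simpa [sub_eq_add_neg] using this
  obtain ⟨s, hs1, hs0⟩ := ((h2.eventually_gt_atTop 0).and (eventually_gt_atTop 0)).exists
  have hsa : 0 < s * a := mul_pos hs0 ha
  have h3 := mul_pos hs1 (pow_pos hsa 2)
  have h4 : ((d * c) * (Real.exp (s * a) / (s * a) ^ 2) -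
      (d + Real.log K) / (s * a) ^ 2 - D / a / (s * a)) * (s * a) ^ 2 =
      d * c * Real.exp (s * a) - (d + Real.log K) - s * D := by
    field_simp
  rw [h4] at h3
  have := h1 s hs0
  nlinarith

/-- A random variable whose tail along a lattice decays at most geometrically has an infinite
exponential moment. -/
theorem exists_lintegral_exp_eq_top {Ω : Type*} [MeasurableSpace Ω] {P : Measure Ω}
    [IsProbabilityMeasure P] {Y : Ω → ℝ} (hY : Measurable Y) {a : ℝ} (ha : 0 < a)
    (hpos : ∀ x : ℝ, 0 < P {ω | x < Y ω}) {M : ℝ≥0} {n₀ : ℕ}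
    (h : ∀ n : ℕ, n₀ ≤ n → P {ω | (n : ℝ) * a < Y ω} ≤
      M * P {ω | ((n : ℝ) + 1) * a < Y ω}) :
    ∃ s > 0, ∫⁻ ω, ENNReal.ofReal (Real.exp (s * Y ω)) ∂P = ∞ := by
  -- With `exp (s * a) ≥ 2 * (M + 1)`, each lattice step gains a factor 2 in Markov's inequality
  -- over the decay of the tail.
  obtain ⟨s, hs2, hs0⟩ := (((tendsto_id.atTop_mul_const ha).eventually
    (Real.tendsto_exp_atTop.eventually_ge_atTop (2 * (M + 1) : ℝ))).and
    (eventually_gt_atTop (0 : ℝ))).exists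
  refine ⟨s, hs0, ?_⟩
  by_contra hfin
  set E := ∫⁻ ω, ENNReal.ofReal (Real.exp (s * Y ω)) ∂P
  set T : ℕ → ℝ≥0∞ := fun n => P {ω | (n : ℝ) * a < Y ω}
  have hM : ∀ k, T n₀ ≤ (M + 1 : ℝ≥0∞) ^ k * T (n₀ + k) := by
    intro k
    induction k with
    | zero => simp
    | succ k ih =>
      refine ih.trans ?_
      rw [pow_succ, mul_assoc]
      gcongr
      refine (h (n₀ + k) (by omega)).trans ?_
      simp only [T]
      push_cast
      rw [add_assoc]
      gcongr
      exact le_self_add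
  have hmarkov : ∀ k : ℕ, ENNReal.ofReal (Real.exp (s * a)) ^ k * T (n₀ + k) ≤ E := by
    intro k
    have := mul_meas_ge_le_lintegral₀ (μ := P) (f := fun ω => ENNReal.ofReal (Real.exp (s * Y ω)))
      (by fun_prop) (ENNReal.ofReal (Real.exp (s * a)) ^ k)
    refine le_trans ?_ this
    refine mul_le_mul_right (measure_mono fun ω (hω : ((n₀ + k : ℕ) : ℝ) * a < Y ω) => ?_) _
    simp only [Set.mem_ofPred_eq]
    rw [← ENNReal.ofReal_pow (Real.exp_pos _).le, ← Real.exp_nat_mul]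
    rw [mul_left_comm]
    push_cast at hω
    have : (0 : ℝ) ≤ n₀ * a := by positivity
    gcongr
    linarith
  have hb : ∀ k : ℕ, T n₀ * 2 ^ k ≤ E := by
    intro k
    have h2 : (2 * (M + 1) : ℝ≥0∞) ≤ ENNReal.ofReal (Real.exp (s * a)) := by
      have := ENNReal.ofReal_le_ofReal hs2
      rw [ENNReal.ofReal_mul (by norm_num), ENNReal.ofReal_add (by positivity) (by norm_num)] at this
      simpa using this
    calc T n₀ * 2 ^ k ≤ (M + 1 : ℝ≥0∞) ^ k * T (n₀ + k) * 2 ^ k := by gcongr; exact hM k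
      _ = (2 * (M + 1) : ℝ≥0∞) ^ k * T (n₀ + k) := by rw [mul_pow]; ring
      _ ≤ ENNReal.ofReal (Real.exp (s * a)) ^ k * T (n₀ + k) := by gcongr
      _ ≤ E := hmarkov k
  have hT0 : T n₀ ≠ 0 := (hpos _).ne'
  have htop : Tendsto (fun k : ℕ => T n₀ * (k : ℝ≥0∞)) atTop (𝓝 ∞) := by
    have := ENNReal.Tendsto.const_mul (a := T n₀) ENNReal.tendsto_nat_nhds_top
      (Or.inl (by simp))
    rwa [ENNReal.mul_top hT0] at this
  refine hfin (top_le_iff.1 (le_of_tendsto' htop fun k => le_trans ?_ (hb k)))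
  gcongr
  exact_mod_cast Nat.lt_two_pow_self.le

/-! ### Laws and moments of the compound Poisson process -/

theorem IsPoissonProcess.map_eq {Ω : Type*} [MeasurableSpace Ω] {N : ℝ≥0 → Ω → ℕ} {r : ℝ≥0}
    {P : Measure Ω} (h : IsPoissonProcess N r P) (t : ℝ≥0) :
    P.map (N t) = poissonMeasure (r * t) := by
  have := h.law_increments 0 t zero_le
  rw [tsub_zero] at this
  rw [← this]
  refine Measure.map_congr ?_
  filter_upwards [h.zero] with ω hω
  simp [hω]

namespace IsCompoundPoissonData

variable {Ω : Type*} [MeasurableSpace Ω] {P : Measure Ω} {N : ℝ≥0 → Ω → ℕ} {ξ : ℕ → Ω → ℝ}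
  {r : ℝ≥0}

theorem indepFun_apply (h : IsCompoundPoissonData N ξ r P) (t : ℝ≥0) :
    IndepFun (N t) (fun ω k => ξ k ω) P :=
  h.indep.comp (measurable_pi_apply t) measurable_id

theorem measurable_jumps (h : IsCompoundPoissonData N ξ r P) :
    Measurable (fun ω k => ξ k ω) :=
  measurable_pi_lambda _ h.measurable_jump

theorem measurable_compoundPoisson (h : IsCompoundPoissonData N ξ r P) (t : ℝ≥0) :
    Measurable (compoundPoisson N ξ t) := by
  have h1 : Measurable fun p : ℕ × Ω => ∑ i ∈ Finset.range p.1, ξ i p.2 :=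
    measurable_from_prod_countable_right fun k =>
      Finset.measurable_fun_sum (Finset.range k) fun i _ => h.measurable_jump i
  exact h1.comp ((h.poisson.measurable t).prodMk measurable_id)

theorem measure_lt_compoundPoisson (h : IsCompoundPoissonData N ξ r P) (t : ℝ≥0) (x : ℝ) :
    P {ω | x < compoundPoisson N ξ t ω} =
      ∑' k, poissonMeasure (r * t) {k} * P {ω | x < ∑ i ∈ Finset.range k, ξ i ω} := by
  rw [← h.poisson.map_eq t]
  exact measure_comp_randomIndex (h.poisson.measurable t) h.measurable_jumps (h.indepFun_apply t)
    (A := fun k => {y | x < ∑ i ∈ Finset.range k, y i})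
    (fun k => measurableSet_lt measurable_const (by fun_prop))

theorem measure_exists_lt_sum (h : IsCompoundPoissonData N ξ r P) (t : ℝ≥0) (x : ℝ) :
    P {ω | ∃ j ≤ N t ω, x < ∑ i ∈ Finset.range j, ξ i ω} =
      ∑' k, poissonMeasure (r * t) {k} *
        P {ω | ∃ j ≤ k, x < ∑ i ∈ Finset.range j, ξ i ω} := by
  rw [← h.poisson.map_eq t]
  refine measure_comp_randomIndex (h.poisson.measurable t) h.measurable_jumps (h.indepFun_apply t)
    (A := fun k => {y | ∃ j ≤ k, x < ∑ i ∈ Finset.range j, y i}) (fun k => ?_)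
  have : {y : ℕ → ℝ | ∃ j ≤ k, x < ∑ i ∈ Finset.range j, y i} =
      ⋃ j, ⋃ (_ : j ≤ k), {y | x < ∑ i ∈ Finset.range j, y i} := by
    ext y; simp
  rw [this]
  exact MeasurableSet.iUnion fun j => MeasurableSet.iUnion fun _ =>
    measurableSet_lt measurable_const (by fun_prop)

theorem exists_measure_exists_lt_sum_le (h : IsCompoundPoissonData N ξ r P) (hr : 0 < r)
    (t : ℝ≥0) {t' : ℝ≥0} (ht' : 0 < t') {ε : ℝ≥0} (hε : 0 < ε) :
    ∃ C : ℝ≥0, ∀ x : ℝ, P {ω | ∃ j ≤ N t ω, x < ∑ i ∈ Finset.range j, ξ i ω} ≤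
      (1 + ε) * P {ω | x < compoundPoisson N ξ t ω} +
        C * P {ω | x < compoundPoisson N ξ t' ω} := by
  obtain ⟨C, hC⟩ := exists_tsum_poissonMeasure_exists_le P
    (fun k ω => ∑ i ∈ Finset.range k, ξ i ω) (r * t) (mul_pos hr ht') hε
  refine ⟨C, fun x => ?_⟩
  rw [h.measure_exists_lt_sum, h.measure_lt_compoundPoisson, h.measure_lt_compoundPoisson]
  exact hC x

theorem lintegral_exp_compoundPoisson [IsProbabilityMeasure P]
    (h : IsCompoundPoissonData N ξ r P) (t : ℝ≥0) {s : ℝ}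
    (hfin : ∫⁻ ω, ENNReal.ofReal (Real.exp (s * ξ 0 ω)) ∂P ≠ ∞) :
    ∫⁻ ω, ENNReal.ofReal (Real.exp (s * compoundPoisson N ξ t ω)) ∂P = ENNReal.ofReal
      (Real.exp (r * t * ((∫⁻ ω, ENNReal.ofReal (Real.exp (s * ξ 0 ω)) ∂P).toReal - 1))) := by
  have h1 := lintegral_comp_randomIndex (h.poisson.measurable t) h.measurable_jumps
    (h.indepFun_apply t)
    (F := fun k y => ENNReal.ofReal (Real.exp (s * ∑ i ∈ Finset.range k, y i)))
    (fun k => by fun_prop)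
  have hg : Measurable fun x : ℝ => ENNReal.ofReal (Real.exp (s * x)) := by fun_prop
  have h2 : ∀ k, ∫⁻ ω, ENNReal.ofReal (Real.exp (s * ∑ i ∈ Finset.range k, ξ i ω)) ∂P =
      ENNReal.ofReal (∫⁻ ω, ENNReal.ofReal (Real.exp (s * ξ 0 ω)) ∂P).toReal ^ k := by
    intro k
    rw [ENNReal.ofReal_toReal hfin]
    simp_rw [Finset.mul_sum, Real.exp_sum, ENNReal.ofReal_prod_of_nonneg
      fun i _ => (Real.exp_pos _).le]
    rw [lintegral_prod_eq_prod_lintegral_of_indepFun (Finset.range k)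
      (fun i ω => ENNReal.ofReal (Real.exp (s * ξ i ω)))
      (h.indep_jumps.comp (fun _ x => ENNReal.ofReal (Real.exp (s * x))) fun _ => hg)
      (fun i => hg.comp (h.measurable_jump i))]
    have : ∀ i, ∫⁻ ω, ENNReal.ofReal (Real.exp (s * ξ i ω)) ∂P =
        ∫⁻ ω, ENNReal.ofReal (Real.exp (s * ξ 0 ω)) ∂P := fun i =>
      ((h.identDistrib_jumps i).comp hg).lintegral_eq
    simp [this]
  simp_rw [h2] at h1
  rw [h.poisson.map_eq, tsum_poissonMeasure_mul_pow _ ENNReal.toReal_nonneg] at h1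
  exact_mod_cast h1

theorem measure_lt_compoundPoisson_pos (h : IsCompoundPoissonData N ξ r P) (hr : 0 < r)
    (hpos : ∀ x : ℝ, 0 < P {ω | x < ξ 0 ω}) {t : ℝ≥0} (ht : 0 < t) (x : ℝ) :
    0 < P {ω | x < compoundPoisson N ξ t ω} := by
  rw [h.measure_lt_compoundPoisson]
  refine lt_of_lt_of_le ?_ (ENNReal.le_tsum 1)
  refine ENNReal.mul_pos ?_ (by simpa using (hpos x).ne')
  rw [poissonMeasure_singleton]
  have : (0 : ℝ) < (r * t : ℝ≥0) := mul_pos hr ht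
  simp only [ne_eq, ENNReal.ofReal_eq_zero, not_le]
  positivity

theorem ae_lattice (h : IsCompoundPoissonData N ξ r P) {a : ℝ}
    (hlat : ∀ᵐ ω ∂P, ∃ n : ℤ, ξ 0 ω = n * a) :
    ∀ᵐ ω ∂P, ∀ k, ∃ n : ℤ, ∑ i ∈ Finset.range k, ξ i ω = n * a := by
  have hms : MeasurableSet {x : ℝ | ∃ n : ℤ, x = n * a} := by
    have : {x : ℝ | ∃ n : ℤ, x = n * a} = Set.range fun n : ℤ => (n : ℝ) * a := by
      ext x; simp [eq_comm]
    rw [this]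
    exact (Set.countable_range _).measurableSet
  have hall : ∀ᵐ ω ∂P, ∀ i, ∃ n : ℤ, ξ i ω = n * a :=
    ae_all_iff.2 fun i => (h.identDistrib_jumps i).symm.ae_snd hms hlat
  filter_upwards [hall] with ω hω k
  choose n hn using hω
  exact ⟨∑ i ∈ Finset.range k, n i, by simp [hn, Finset.sum_mul]⟩

theorem measure_ne_increment (h : IsCompoundPoissonData N ξ r P) {s t : ℝ≥0} (hst : s ≤ t) :
    P {ω | N t ω ≠ N s ω} = 1 - ENNReal.ofReal (Real.exp (-(r * (t - s) : ℝ≥0))) := by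
  have hm : Measurable fun ω => N t ω - N s ω :=
    (measurable_of_countable fun p : ℕ × ℕ => p.1 - p.2).comp
      ((h.poisson.measurable t).prodMk (h.poisson.measurable s))
  have h1 : P {ω | N t ω ≠ N s ω} = P ((fun ω => N t ω - N s ω) ⁻¹' {0}ᶜ) := by
    refine measure_congr ?_
    filter_upwards [h.poisson.monotone_paths] with ω hω
    have := hω hst
    apply propext
    change N t ω ≠ N s ω ↔ ¬ (N t ω - N s ω = 0)
    simp only at this
    omega
  rw [h1, ← Measure.map_apply hm (MeasurableSet.of_discrete), h.poisson.law_increments s t hst,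
    prob_compl_eq_one_sub (MeasurableSet.of_discrete), poissonMeasure_singleton]
  simp

/-- With probability tending to 1, `N` is constant on `[1 - 1 / (n + 1), 1]`, so the value at time 1
is already taken earlier. -/
theorem measure_le_compoundPoisson_one_le (h : IsCompoundPoissonData N ξ r P) (x : ℝ) :
    P {ω | x ≤ compoundPoisson N ξ 1 ω} ≤
      P {ω | ∃ t < 1, x ≤ compoundPoisson N ξ t ω} := by
  set A := P {ω | ∃ t < 1, x ≤ compoundPoisson N ξ t ω}
  have h1 : ∀ n : ℕ, P {ω | x ≤ compoundPoisson N ξ 1 ω} ≤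
      A + (1 - ENNReal.ofReal (Real.exp (-(r * (1 / (n + 1) : ℝ))))) := by
    intro n
    have hle : (1 / (n + 1) : ℝ≥0) ≤ 1 := by
      rw [div_le_one (by positivity)]; simp
    have hs : 1 - (1 / (n + 1) : ℝ≥0) < 1 := tsub_lt_self one_pos (by positivity)
    have := h.measure_ne_increment (tsub_le_self : 1 - (1 / (n + 1) : ℝ≥0) ≤ 1)
    rw [tsub_tsub_cancel_of_le hle] at this
    push_cast at this
    rw [← this]
    refine le_trans (measure_mono fun ω hω => ?_) (measure_union_le _ _)
    by_cases hne : N 1 ω = N (1 - (1 / (n + 1) : ℝ≥0)) ω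
    · refine Or.inl ⟨_, hs, ?_⟩
      change x ≤ compoundPoisson N ξ 1 ω at hω
      simpa only [compoundPoisson, ← hne] using hω
    · exact Or.inr hne
  have h0 : Tendsto (fun n : ℕ => A + (1 - ENNReal.ofReal
      (Real.exp (-(r * (1 / (n + 1) : ℝ)))))) atTop (𝓝 (A + (1 - ENNReal.ofReal 1))) := by
    refine tendsto_const_nhds.add (ENNReal.Tendsto.sub tendsto_const_nhds
      ((ENNReal.continuous_ofReal.tendsto _).comp ?_) (by simp))
    have := (tendsto_one_div_add_atTop_nhds_zero_nat (𝕜 := ℝ)).const_mul (r : ℝ)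
    have := (Real.continuous_exp.tendsto _).comp this.neg
    simpa [Function.comp_def] using this
  simpa using ge_of_tendsto' h0 h1

end IsCompoundPoissonData

/-! ### The drifted process along lattice and half-lattice levels -/

theorem mul_exp_le_toReal_lintegral_exp {Ω : Type*} [MeasurableSpace Ω] {P : Measure Ω}
    {Y : Ω → ℝ} (hY : Measurable Y) (a : ℝ) {s : ℝ} (hs : 0 < s)
    (hfin : ∫⁻ ω, ENNReal.ofReal (Real.exp (s * Y ω)) ∂P ≠ ∞) :
    P.real {ω | a < Y ω} * Real.exp (s * a) ≤
      (∫⁻ ω, ENNReal.ofReal (Real.exp (s * Y ω)) ∂P).toReal := by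
  have h := mul_meas_ge_le_lintegral₀ (μ := P)
    (f := fun ω => ENNReal.ofReal (Real.exp (s * Y ω))) (by fun_prop)
    (ENNReal.ofReal (Real.exp (s * a)))
  have h2 : ENNReal.ofReal (Real.exp (s * a)) * P {ω | a < Y ω} ≤
      ∫⁻ ω, ENNReal.ofReal (Real.exp (s * Y ω)) ∂P := by
    refine le_trans (mul_le_mul_right (measure_mono fun ω (hω : a < Y ω) => ?_) _) h
    change ENNReal.ofReal _ ≤ ENNReal.ofReal _
    gcongr
  have h3 := ENNReal.toReal_mono hfin h2
  rwa [ENNReal.toReal_mul, ENNReal.toReal_ofReal (Real.exp_pos _).le, mul_comm] at h3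

theorem lt_supUnitInterval_iff {Ω : Type*} (X : ℝ≥0 → Ω → ℝ) (u : ℝ) (ω : Ω) :
    (u : EReal) < supUnitInterval X ω ↔ ∃ t ≤ 1, u < X t ω := by
  simp [supUnitInterval, lt_iSup_iff]

theorem setOf_lt_driftedCompoundPoisson_one {Ω : Type*} (N : ℝ≥0 → Ω → ℕ) (ξ : ℕ → Ω → ℝ)
    (b u : ℝ) :
    {ω | u - b < driftedCompoundPoisson N ξ b 1 ω} = {ω | u < compoundPoisson N ξ 1 ω} := by
  ext ω
  simp [driftedCompoundPoisson]

namespace IsCompoundPoissonData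

variable {Ω : Type*} [MeasurableSpace Ω] {P : Measure Ω} {N : ℝ≥0 → Ω → ℕ} {ξ : ℕ → Ω → ℝ}
  {r : ℝ≥0}

theorem not_eventually_measure_lt_le [IsProbabilityMeasure P] (h : IsCompoundPoissonData N ξ r P)
    (hr : 0 < r) {a : ℝ} (ha : 0 < a) (hpos : 0 < P.real {ω | a < ξ 0 ω})
    (hfin : ∀ s > 0, ∫⁻ ω, ENNReal.ofReal (Real.exp (s * ξ 0 ω)) ∂P ≠ ∞)
    {t : ℝ≥0} (ht : t < 1) (m : ℝ) (C : ℝ≥0) :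
    ¬ ∀ᶠ n : ℕ in atTop, P {ω | ((n : ℝ) - 1 / 2) * a < compoundPoisson N ξ 1 ω} ≤
      C * P {ω | ((n : ℝ) - 1 / 2) * a - m < compoundPoisson N ξ t ω} := by
  intro hev
  obtain ⟨n₀, hn₀⟩ := eventually_atTop.1 hev
  have htail : ∀ x ≥ (n₀ : ℝ) * a, P {ω | x < compoundPoisson N ξ 1 ω} ≤
      C * P {ω | x - (m + a) < compoundPoisson N ξ t ω} := by
    intro x hx
    have hx0 : 0 ≤ x / a + 1 / 2 := by
      have : 0 ≤ x := le_trans (by positivity) hx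
      positivity
    have hxa : x / a * a = x := div_mul_cancel₀ x ha.ne'
    -- The largest half-lattice level not above `x`; it is within `a` of `x`, whence the shift `m +
    -- a`.
    set n := ⌊x / a + 1 / 2⌋₊
    have h1 : (n : ℝ) ≤ x / a + 1 / 2 := Nat.floor_le hx0
    have h2 : x / a + 1 / 2 < n + 1 := Nat.lt_floor_add_one _
    have h3 : n₀ ≤ n := Nat.le_floor (by
      have : (n₀ : ℝ) ≤ x / a := (le_div_iff₀ ha).2 hx
      linarith)
    have h4 : ((n : ℝ) - 1 / 2) * a ≤ x := by nlinarith
    have h5 : x - a ≤ ((n : ℝ) - 1 / 2) * a := by nlinarith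
    refine (measure_mono fun ω hω => ?_).trans ((hn₀ n h3).trans (by
      refine mul_le_mul_right (measure_mono fun ω hω => ?_) _
      exact lt_of_le_of_lt (b := ((n : ℝ) - 1 / 2) * a - m) (by linarith) hω))
    exact lt_of_le_of_lt h4 hω
  have hφ := fun s (hs : s > 0) =>
    mul_exp_le_toReal_lintegral_exp (h.measurable_jump 0) a hs (hfin s hs)
  have htr : (r : ℝ) * t < r * (1 : ℝ≥0) :=
    mul_lt_mul_of_pos_left (by exact_mod_cast ht) (by exact_mod_cast hr)
  refine not_forall_exp_mul_le hpos ha hφ (by positivity) htr (n₀ * a) (m + a) C C.coe_nonneg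
    fun s hs => ?_
  have := lintegral_exp_le_of_tail_le (h.measurable_compoundPoisson 1)
    (h.measurable_compoundPoisson t) htail hs
  rw [h.lintegral_exp_compoundPoisson _ (hfin s hs), h.lintegral_exp_compoundPoisson _ (hfin s hs),
    ← ENNReal.ofReal_coe_nnreal, ← ENNReal.ofReal_mul (Real.exp_pos _).le,
    ← ENNReal.ofReal_mul C.coe_nonneg, ← ENNReal.ofReal_add (by positivity) (by positivity),
    ENNReal.ofReal_le_ofReal_iff (by positivity)] at this
  exact this

theorem measure_lt_supUnitInterval_le (h : IsCompoundPoissonData N ξ r P) {a b : ℝ} (ha : 0 < a)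
    (hb : 0 < b) (hlat : ∀ᵐ ω ∂P, ∃ n : ℤ, ξ 0 ω = n * a) {t₀ : ℝ≥0}
    (ht₀ : (1 - (t₀ : ℝ)) * b ≤ a / 2) (n : ℕ) :
    P {ω | ((((n : ℝ) - 1 / 2) * a - b : ℝ) : EReal) <
        supUnitInterval (driftedCompoundPoisson N ξ b) ω} ≤
      P {ω | ∃ j ≤ N 1 ω, ((n : ℝ) - 1 / 2) * a < ∑ i ∈ Finset.range j, ξ i ω} +
      P {ω | ∃ j ≤ N t₀ ω, ((n : ℝ) - 1 / 2) * a - b < ∑ i ∈ Finset.range j, ξ i ω} := by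
  refine le_trans (measure_mono_ae ?_) (measure_union_le _ _)
  filter_upwards [h.ae_lattice hlat, h.poisson.monotone_paths] with ω hω hmono hsup
  obtain ⟨t, ht1, ht⟩ := (lt_supUnitInterval_iff _ _ _).1 hsup
  simp only [driftedCompoundPoisson, compoundPoisson] at ht
  have htb : 0 ≤ b * t := by positivity
  -- From `t₀` on, `Z t` exceeds `(n - 1) * a`, hence is at least `n * a`. Before `t₀` the drift is
  -- simply dropped.
  rcases le_total t₀ t with hle | hle
  · refine Or.inl ⟨N t ω, hmono ht1, ?_⟩
    obtain ⟨k, hk⟩ := hω (N t ω)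
    rw [hk] at ht ⊢
    have h1 : b * t₀ ≤ b * t := by gcongr
    have h2 : ((n : ℝ) - 1) * a < k * a := by nlinarith
    have h3 : ((n : ℤ) - 1 : ℤ) < k := by
      have := lt_of_mul_lt_mul_right h2 ha.le
      exact_mod_cast this
    have h4 : (n : ℝ) ≤ k := by exact_mod_cast (by omega : (n : ℤ) ≤ k)
    nlinarith
  · exact Or.inr ⟨N t ω, hmono hle, by linarith⟩

theorem one_le_ratio [IsProbabilityMeasure P] {b u : ℝ}
    (hu : 0 < P {ω | u < driftedCompoundPoisson N ξ b 1 ω}) :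
    1 ≤ P {ω | (u : EReal) < supUnitInterval (driftedCompoundPoisson N ξ b) ω} /
      P {ω | u < driftedCompoundPoisson N ξ b 1 ω} := by
  rw [ENNReal.le_div_iff_mul_le (Or.inl hu.ne') (Or.inl (measure_ne_top _ _)), one_mul]
  exact measure_mono fun ω hω => (lt_supUnitInterval_iff _ _ _).2 ⟨1, le_rfl, hω⟩

theorem frequently_ratio_le [IsProbabilityMeasure P] (h : IsCompoundPoissonData N ξ r P)
    (hr : 0 < r) {a b : ℝ} (ha : 0 < a) (hb : 0 < b)
    (hlat : ∀ᵐ ω ∂P, ∃ n : ℤ, ξ 0 ω = n * a) (hpos : 0 < P.real {ω | a < ξ 0 ω})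
    (hfin : ∀ s > 0, ∫⁻ ω, ENNReal.ofReal (Real.exp (s * ξ 0 ω)) ∂P ≠ ∞)
    {ε : ℝ≥0} (hε : 0 < ε) :
    ∃ᶠ u : ℝ in atTop, P {ω | (u : EReal) < supUnitInterval (driftedCompoundPoisson N ξ b) ω} /
      P {ω | u < driftedCompoundPoisson N ξ b 1 ω} ≤ 1 + ε + ε := by
  have hseq : Tendsto (fun n : ℕ => ((n : ℝ) - 1 / 2) * a - b) atTop atTop :=
    tendsto_atTop_add_const_right _ _ ((tendsto_atTop_add_const_right _ _
      tendsto_natCast_atTop_atTop).atTop_mul_const ha)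
  refine hseq.frequently fun hnot => ?_
  -- Positivity of `t₀` lets its Poisson law absorb the finitely many bad indices; `t₀ < 1` gives
  -- the gap between the moments.
  obtain ⟨t₀, h0, h1, hb₀⟩ : ∃ t₀ : ℝ≥0, 0 < t₀ ∧ t₀ < 1 ∧ (1 - (t₀ : ℝ)) * b ≤ a / 2 := by
    have hδ0 : 0 < min (1 / 2) (a / (2 * b)) := by positivity
    have hδ1 : min (1 / 2) (a / (2 * b)) ≤ 1 / 2 := min_le_left _ _
    have hδ2 : min (1 / 2) (a / (2 * b)) ≤ a / (2 * b) := min_le_right _ _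
    refine ⟨⟨1 - min (1 / 2) (a / (2 * b)), by linarith⟩, ?_, ?_, ?_⟩
    · change (0 : ℝ) < 1 - min (1 / 2) (a / (2 * b)); linarith
    · change 1 - min (1 / 2) (a / (2 * b)) < (1 : ℝ); linarith
    · change (1 - (1 - min (1 / 2) (a / (2 * b)))) * b ≤ a / 2
      calc _ ≤ (1 - (1 - a / (2 * b))) * b := by gcongr
        _ = a / 2 := by field_simp; ring
  obtain ⟨C₁, hC₁⟩ := h.exists_measure_exists_lt_sum_le hr 1 h0 hε
  -- A crude constant suffices here, since both terms are tails of `Z t₀`.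
  obtain ⟨C₂, hC₂⟩ := h.exists_measure_exists_lt_sum_le hr t₀ h0 one_pos
  refine h.not_eventually_measure_lt_le hr ha hpos hfin h1 b (ε⁻¹ * (C₁ + (1 + 1 + C₂))) ?_
  filter_upwards [hnot] with n hn
  rw [not_le, setOf_lt_driftedCompoundPoisson_one] at hn
  set x := ((n : ℝ) - 1 / 2) * a
  set G := P {ω | x < compoundPoisson N ξ 1 ω}
  set R := P {ω | x - b < compoundPoisson N ξ t₀ ω}
  have hR : P {ω | x < compoundPoisson N ξ t₀ ω} ≤ R :=
    measure_mono fun ω (hω : x < _) => (sub_le_self x hb.le).trans_lt hω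
  have hsup : (1 + ε + ε) * G ≤ (1 + ε) * G + (C₁ + (1 + 1 + C₂)) * R := by
    calc (1 + ε + ε) * G ≤ _ := ENNReal.mul_le_of_le_div hn.le
      _ ≤ _ := h.measure_lt_supUnitInterval_le ha hb hlat hb₀ n
      _ ≤ ((1 + ε) * G + C₁ * P {ω | x < compoundPoisson N ξ t₀ ω}) +
            ((1 + (1 : ℝ≥0)) * R + C₂ * R) := add_le_add (hC₁ _) (hC₂ _)
      _ ≤ ((1 + ε) * G + C₁ * R) + ((1 + (1 : ℝ≥0)) * R + C₂ * R) := by gcongr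
      _ = _ := by push_cast; ring
  rw [add_mul (1 + (ε : ℝ≥0∞)) _ G] at hsup
  have hGtop : (1 + (ε : ℝ≥0∞)) * G ≠ ∞ :=
    ENNReal.mul_ne_top (by simp) (measure_ne_top _ _)
  have h3 := (ENNReal.add_le_add_iff_left hGtop).1 hsup
  have hε' : (ε : ℝ≥0∞) ≠ 0 := by simpa using hε.ne'
  calc G = (ε : ℝ≥0∞)⁻¹ * (ε * G) := by
        rw [← mul_assoc, ENNReal.inv_mul_cancel hε' ENNReal.coe_ne_top, one_mul]
    _ ≤ (ε : ℝ≥0∞)⁻¹ * ((C₁ + (1 + 1 + C₂)) * R) := by gcongr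
    _ = _ := by
        rw [← mul_assoc]; push_cast [ENNReal.coe_inv hε.ne']; rfl

theorem limsup_ratio_eq_top [IsProbabilityMeasure P] (h : IsCompoundPoissonData N ξ r P)
    {a b : ℝ} (ha : 0 < a) (hb : 0 < b)
    (hlat : ∀ᵐ ω ∂P, ∃ n : ℤ, ξ 0 ω = n * a)
    (hpos : ∀ x, 0 < P {ω | x < compoundPoisson N ξ 1 ω})
    (hfin : ∀ s > 0, ∫⁻ ω, ENNReal.ofReal (Real.exp (s * ξ 0 ω)) ∂P ≠ ∞) :
    limsup (fun u : ℝ => P {ω | (u : EReal) < supUnitInterval (driftedCompoundPoisson N ξ b) ω} /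
      P {ω | u < driftedCompoundPoisson N ξ b 1 ω}) atTop = ∞ := by
  by_contra hne
  obtain ⟨M, hM, -⟩ := ENNReal.lt_iff_exists_nnreal_btwn.1 (lt_top_iff_ne_top.2 hne)
  have hseq : Tendsto (fun n : ℕ => ((n : ℝ) + 1) * a - b) atTop atTop :=
    tendsto_atTop_add_const_right _ _ ((tendsto_atTop_add_const_right _ _
      tendsto_natCast_atTop_atTop).atTop_mul_const ha)
  obtain ⟨n₀, hn₀⟩ := eventually_atTop.1 (hseq.eventually (eventually_lt_of_limsup_lt hM))
  have htail : ∀ n : ℕ, n₀ ≤ n → P {ω | (n : ℝ) * a < compoundPoisson N ξ 1 ω} ≤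
      M * P {ω | ((n : ℝ) + 1) * a < compoundPoisson N ξ 1 ω} := by
    intro n hn
    have h1 := (hn₀ n hn).le
    rw [setOf_lt_driftedCompoundPoisson_one,
      ENNReal.div_le_iff (hpos _).ne' (measure_ne_top _ _)] at h1
    calc P {ω | (n : ℝ) * a < compoundPoisson N ξ 1 ω}
        ≤ P {ω | ((n : ℝ) + 1) * a ≤ compoundPoisson N ξ 1 ω} := by
          refine measure_mono_ae ?_
          filter_upwards [h.ae_lattice hlat] with ω hω hlt
          obtain ⟨k, hk⟩ := hω (N 1 ω)
          change (n : ℝ) * a < ∑ i ∈ Finset.range (N 1 ω), ξ i ω at hlt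
          change ((n : ℝ) + 1) * a ≤ ∑ i ∈ Finset.range (N 1 ω), ξ i ω
          rw [hk] at hlt ⊢
          have h2 : (n : ℤ) < k := by exact_mod_cast lt_of_mul_lt_mul_right hlt ha.le
          have h3 : (n : ℝ) + 1 ≤ k := by exact_mod_cast h2
          gcongr
      _ ≤ P {ω | ∃ t < 1, ((n : ℝ) + 1) * a ≤ compoundPoisson N ξ t ω} :=
          h.measure_le_compoundPoisson_one_le _
      _ ≤ _ := by
          refine (measure_mono fun ω hω => ?_).trans h1
          obtain ⟨t, ht, hle⟩ := hω
          refine (lt_supUnitInterval_iff _ _ _).2 ⟨t, ht.le, ?_⟩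
          -- Strictness of `t < 1` turns the weak inequality for `Z t` into a strict crossing by `X
          -- t`.
          have : b * (t : ℝ) < b * 1 := mul_lt_mul_of_pos_left (by exact_mod_cast ht) hb
          simp only [driftedCompoundPoisson]
          linarith
  obtain ⟨s, hs, hinf⟩ :=
    exists_lintegral_exp_eq_top (h.measurable_compoundPoisson 1) ha hpos htail
  rw [h.lintegral_exp_compoundPoisson _ (hfin s hs)] at hinf
  exact ENNReal.ofReal_ne_top hinf

end IsCompoundPoissonData

theorem theorem3 {Ω : Type*} [MeasurableSpace Ω] (P : Measure Ω) [IsProbabilityMeasure P]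
    (N : ℝ≥0 → Ω → ℕ) (ξ : ℕ → Ω → ℝ) (r : ℝ≥0) (hr : 0 < r)
    (hZ : IsCompoundPoissonData N ξ r P)
    (a : ℝ) (hlat : IsLatticeWithStep (ξ 0) a P)
    (hpos : ∀ n : ℕ, 0 < P.real {ω | (n : ℝ) * a < ξ 0 ω})
    (hlim : Tendsto
      (fun n : ℕ => P.real {ω | ((n : ℝ) + 1) * a < ξ 0 ω} / P.real {ω | (n : ℝ) * a < ξ 0 ω})
      atTop (𝓝 0))
    (b : ℝ) (hb : 0 < b) :
    (∀ u : ℝ, 0 < P {ω | u < driftedCompoundPoisson N ξ b 1 ω}) ∧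
    limsup (fun u : ℝ =>
        P {ω | (u : EReal) < supUnitInterval (driftedCompoundPoisson N ξ b) ω} /
          P {ω | u < driftedCompoundPoisson N ξ b 1 ω}) atTop = (⊤ : ℝ≥0∞) ∧
    liminf (fun u : ℝ =>
        P {ω | (u : EReal) < supUnitInterval (driftedCompoundPoisson N ξ b) ω} /
          P {ω | u < driftedCompoundPoisson N ξ b 1 ω}) atTop = (1 : ℝ≥0∞) := by
  obtain ⟨ha, hlattice, -⟩ := hlat
  have hfin : ∀ s > 0, ∫⁻ ω, ENNReal.ofReal (Real.exp (s * ξ 0 ω)) ∂P ≠ ∞ := fun s hs =>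
    lintegral_exp_ne_top_of_tail_ratio (hZ.measurable_jump 0) ha hpos hlim hs
  have hjump : ∀ x : ℝ, 0 < P {ω | x < ξ 0 ω} := by
    intro x
    obtain ⟨n, hn⟩ := exists_nat_ge (x / a)
    rw [div_le_iff₀ ha] at hn
    exact (ENNReal.toReal_pos_iff.1 (hpos n)).1.trans_le
      (measure_mono fun ω (hω : (n : ℝ) * a < ξ 0 ω) => hn.trans_lt hω)
  have hcp : ∀ x : ℝ, 0 < P {ω | x < compoundPoisson N ξ 1 ω} :=
    hZ.measure_lt_compoundPoisson_pos hr hjump one_pos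
  have hdrift : ∀ u : ℝ, 0 < P {ω | u < driftedCompoundPoisson N ξ b 1 ω} := by
    intro u
    have := hcp (u + b)
    rwa [← setOf_lt_driftedCompoundPoisson_one N ξ b, add_sub_cancel_right] at this
  refine ⟨hdrift, hZ.limsup_ratio_eq_top ha hb hlattice hcp hfin, le_antisymm ?_ ?_⟩
  · refine ENNReal.le_of_forall_pos_le_add fun ε hε _ => ?_
    have := liminf_le_of_frequently_le' (hZ.frequently_ratio_le hr ha hb hlattice
      (by simpa using hpos 1) hfin (half_pos hε))
    rwa [add_assoc, ← ENNReal.coe_add, add_halves] at this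
  · exact le_liminf_of_le (by isBoundedDefault)
      (Eventually.of_forall fun u => IsCompoundPoissonData.one_le_ratio (hdrift u))
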